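/- **Proposition (spherical convolution).** Let $S^2\subset\mathbb R^3$ be the unit sphere with its surface measure $dx$ (total mass $4\pi$), let $\nu=(0,0,1)$ be the north pole, and let $dg$ be the Haar measure on $SO(3)$ of total mass $8\pi^2$ (so that $\int_{SO(3)}F(g\nu)\,dg=2\pi\int_{S^2}F(x)\,dx$). For $\ell\in\mathbb N$ and $m\in\mathbb Z$ with $|m|\le \ell$ let $$Y^\ell_m(\theta,\phi)=\sqrt{\frac{2\ell+1}{4\pi}\,\frac{(\ell-m)!}{(\ell+m)!}}\;P^\ell_m(\cos\theta)\,e^{im\phi},\qquad P^\ell_m(t)=\frac{(-1)^{\ell+m}}{2^\ell\,\ell!}(1-t^2)^{m/2}\frac{d^{\ell+m}}{dt^{\ell+m}}(1-t^2)^\ell,$$ be the spherical harmonics at the point $x=(\sin\theta\cos\phi,\sin\theta\sin\phi,\cos\theta)$ of $S^2$, extended continuously to the poles, and for $f\in L^2(S^2)$ (complex valued) write $\hat f^\ell_m=\int_{S^2}f(x)\,\overline{Y^\ell_m(x)}\,dx$. For $f,k\in L^2(S^2)$ define the spherical convolution $$(f*k)(x)=\int_{SO(3)}f(g\nu)\,k(g^{-1}x)\,dg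 .$$ Then for all $f,k\in L^2(S^2)$ the integrand is integrable over $SO(3)$ for every $x\in S^2$, $f*k\in L^2(S^2)$, and for all $\ell\in\mathbb N$ and all $m\in\mathbb Z$ with $|m|\le\ell$, $$\widehat{(f*k)}{}^\ell_m=2\pi\sqrt{\frac{4\pi}{2\ell+1}}\;\hat f^\ell_m\,\hat k^\ell_0 .$$ In particular only the zonal part of the filter matters: for every $k\in L^2(S^2)$ there is a function $k_0\in L^2(S^2)$ that is zonal (invariant under all rotations fixing $\nu$), with $(\hat k_0)^\ell_0=\hat k^\ell_0$ for all $\ell$ and $(\hat k_0)^\ell_m=0$ for all $\ell$ and all $m$ with $0<|m|\le\ell$, such that $(f*k)(x)=(f*k_0)(x)$ for all $f\in L^2(S^2)$ and all $x\in S^2$. -/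

import Mathlib

namespace SphericalConv

open MeasureTheory

noncomputable section

/-- Three-dimensional Euclidean space. -/
abbrev E3 : Type := EuclideanSpace ℝ (Fin 3)

/-- The unit sphere `S²` in three-dimensional Euclidean space. -/
abbrev S2 : Type := Metric.sphere (0 : E3) 1

/-- The rotation group `SO(3)`: real orthogonal `3 × 3` matrices of determinant one. -/
abbrev SO3 : Type := Matrix.specialOrthogonalGroup (Fin 3) ℝ

/-! ### Topology and Haar measure of the rotation group -/

instance : IsTopologicalGroup SO3 where
  continuous_inv := by
    refine Continuous.subtype_mk (f := fun g : SO3 => star (g : Matrix (Fin 3) (Fin 3) ℝ)) ?_ _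
    exact continuous_star.comp continuous_subtype_val

instance : CompactSpace SO3 := by
  refine (isCompact_iff_compactSpace (s := ((Matrix.specialOrthogonalGroup (Fin 3) ℝ :
    Submonoid _) : Set (Matrix (Fin 3) (Fin 3) ℝ)))).1 ?_
  have hK : IsCompact (Set.univ.pi fun _ : Fin 3 => Set.univ.pi fun _ : Fin 3 =>
      Set.Icc (-1 : ℝ) 1) :=
    isCompact_univ_pi fun _ => isCompact_univ_pi fun _ => isCompact_Icc
  refine hK.of_isClosed_subset ?_ ?_
  · have h : ((Matrix.specialOrthogonalGroup (Fin 3) ℝ : Submonoid _) :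
        Set (Matrix (Fin 3) (Fin 3) ℝ)) = {A | A * star A = 1} ∩ {A | A.det = 1} := by
      ext A
      simp only [SetLike.mem_coe, Matrix.mem_specialOrthogonalGroup_iff,
        Matrix.mem_orthogonalGroup_iff, Set.mem_inter_iff, Set.mem_ofPred_eq]
      rfl
    rw [h]
    exact (isClosed_eq (continuous_id.mul continuous_star) continuous_const).inter
      (isClosed_eq (Continuous.matrix_det continuous_id) continuous_const)
  · intro A hA i _ j _
    have h := entry_norm_bound_of_unitary
      (Matrix.mem_specialOrthogonalGroup_iff.1 hA).1 i j
    rw [Real.norm_eq_abs, abs_le] at h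
    exact h

instance : MeasurableSpace SO3 := borel SO3

instance : BorelSpace SO3 := ⟨rfl⟩

/-- The measure `dg` on `SO(3)`: the Haar measure of total mass `8π²`. This is the normalization
`∫_{SO(3)} F(g) dg = ∫_{S²} ∫_{SO(2)} F(g_x h) dh dx` (with `g_x` carrying the north pole to `x`)
for the surface measure `dx` on `S²`, of mass `4π`, and the angle measure `dh` on `SO(2)`,
of mass `2π`. In ZYZ Euler angles `dg = sin β dα dβ dγ`. -/
def haarSO3 : Measure SO3 :=
  ENNReal.ofReal (8 * Real.pi ^ 2) •
    Measure.haarMeasure (⊤ : TopologicalSpace.PositiveCompacts SO3)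

/-! ### The sphere -/

/-- The surface measure on `S²`, of total mass `4π`. -/
def surfaceMeasure : Measure S2 := (volume : Measure E3).toSphere

/-- The north pole `ν = (0, 0, 1)`. -/
def northPole : S2 := ⟨!₂[0, 0, 1], by simp [EuclideanSpace.norm_eq, Fin.sum_univ_three]⟩

/-- The rotation `g` applied to the point `x` of the sphere (matrix times vector). -/
def rotate (g : SO3) (x : S2) : S2 :=
  ⟨WithLp.toLp 2 ((g : Matrix (Fin 3) (Fin 3) ℝ).mulVec (WithLp.ofLp (x : E3))), by
    have hg := (Matrix.mem_orthogonalGroup_iff' (Fin 3) ℝ).1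
      (Matrix.mem_specialOrthogonalGroup_iff.1 g.2).1
    have hx : ‖(x : E3)‖ = 1 := by simp
    have h : ∀ v : E3, ‖v‖ ^ 2 = dotProduct (WithLp.ofLp v) (WithLp.ofLp v) := by
      intro v
      rw [EuclideanSpace.norm_sq_eq]
      simp [dotProduct, sq]
    have h2 : ‖(WithLp.toLp 2 ((g : Matrix (Fin 3) (Fin 3) ℝ).mulVec
        (WithLp.ofLp (x : E3))) : E3)‖ ^ 2 = 1 := by
      rw [h, Matrix.dotProduct_mulVec, ← Matrix.mulVec_transpose, Matrix.mulVec_mulVec]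
      have hg' : (g : Matrix (Fin 3) (Fin 3) ℝ).transpose * (g : Matrix (Fin 3) (Fin 3) ℝ) = 1 :=
        hg
      rw [hg', Matrix.one_mulVec, ← h, hx, one_pow]
    rw [mem_sphere_zero_iff_norm]
    exact (pow_eq_one_iff_of_nonneg (norm_nonneg _) two_ne_zero).1 h2⟩

/-- A function on the sphere is zonal if it is invariant under all rotations that fix the
north pole, i.e. constant on latitudes. -/
def IsZonal (k : S2 → ℂ) : Prop :=
  ∀ g : SO3, rotate g northPole = northPole → ∀ x : S2, k (rotate g x) = k x

/-! ### Spherical harmonics -/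

/-- The associated Legendre function
`P_m^ℓ(t) = (-1)^(ℓ+m) / (2^ℓ ℓ!) * (1 - t²)^(m/2) * (d/dt)^(ℓ+m) (1 - t²)^ℓ`, for `|m| ≤ ℓ`. -/
def assocLegendre (ℓ : ℕ) (m : ℤ) (t : ℝ) : ℝ :=
  (-1) ^ ((ℓ : ℤ) + m).toNat / (2 ^ ℓ * (ℓ.factorial : ℝ)) * (1 - t ^ 2) ^ ((m : ℝ) / 2) *
    (Polynomial.derivative^[((ℓ : ℤ) + m).toNat]
      ((1 - Polynomial.X ^ 2) ^ ℓ : Polynomial ℝ)).eval t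

/-- The spherical harmonic of degree `ℓ` and order `m`, `|m| ≤ ℓ`, as a function of the polar
angle `θ` and the azimuth `φ`. -/
def harmonicAngle (ℓ : ℕ) (m : ℤ) (θ φ : ℝ) : ℂ :=
  (Real.sqrt ((2 * ℓ + 1) / (4 * Real.pi) *
      ((((ℓ : ℤ) - m).toNat.factorial : ℝ) / (((ℓ : ℤ) + m).toNat.factorial : ℝ))) : ℂ) *
    (assocLegendre ℓ m (Real.cos θ) : ℂ) * Complex.exp (Complex.I * m * φ)

/-- The polar angle `θ ∈ [0, π]` of a point `(sin θ cos φ, sin θ sin φ, cos θ)`. -/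
def polar (x : S2) : ℝ := Real.arccos ((x : E3) 2)

/-- The azimuth `φ ∈ (-π, π]` of a point `(sin θ cos φ, sin θ sin φ, cos θ)` (and `0` at the
poles, where the spherical harmonics do not depend on it). -/
def azimuth (x : S2) : ℝ := Complex.arg ⟨(x : E3) 0, (x : E3) 1⟩

/-- The spherical harmonic `Y_m^ℓ` as a function on the sphere. -/
def sphericalHarmonic (ℓ : ℕ) (m : ℤ) (x : S2) : ℂ :=
  harmonicAngle ℓ m (polar x) (azimuth x)

/-- The spherical harmonic coefficient `f̂_m^ℓ = ∫_{S²} f(x) conj(Y_m^ℓ(x)) dx`. -/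
def coeff (f : S2 → ℂ) (ℓ : ℕ) (m : ℤ) : ℂ :=
  ∫ x, f x * (starRingEnd ℂ) (sphericalHarmonic ℓ m x) ∂surfaceMeasure

/-! ### Spherical convolution -/

/-- The spherical convolution `(f * k)(x) = ∫_{SO(3)} f(gν) k(g⁻¹x) dg`. -/
def conv (f k : S2 → ℂ) (x : S2) : ℂ :=
  ∫ g, f (rotate g northPole) * k (rotate g⁻¹ x) ∂haarSO3

end

end SphericalConv

/-!
The proof rests on three facts about the action of the rotation group on the sphere.

*Integration.* Compact groups are unimodular, the surface measure is rotation invariant and the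
action is transitive. Hence every orbit map `g ↦ g x`, and also `g ↦ g⁻¹ x`, pushes the Haar measure
to `2π` times the surface measure (`map_rotate_haarSO3`, `map_rotate_inv_haarSO3`). Both factors of
the convolution integrand are therefore square integrable for every `x`, the convolution is bounded,
and it does not change at any point if the functions are modified on null sets.

*A mean value property.* Write `w = x₀ + i x₁` and `z = x₂`. Up to constants, the spherical
harmonics of degree `ℓ` at `x` are the coefficients in `h` of
`(w h² / 2 + z h - conj w / 2) ^ ℓ = (v · x) ^ ℓ`, where `v` is a null vector depending on `h`
(`sphericalHarmonic_eq`); for `w ≠ 0` rescaling `h` by `w` turns this into the Taylor expansion of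
`(z² - 1) ^ ℓ`, that is Rodrigues' formula. Rotating `x` by an angle `φ` about the vertical axis
turns the power of any null linear form into `(a u + c + b u⁻¹) ^ ℓ` with `u = e ^ (i φ)`, and
averaging over the roots of unity `u` of order `ℓ + 1` leaves the term without `u`. This term only
depends on `c` and `a b`, and for null vectors these are functions of the height of `x`.
As rotations preserve null vectors, the mean of `Y (g r x)` over these rotations `r` is `Y (g ν) P_ℓ(x₂)`
(`sum_sphericalHarmonic_rotRoot`). By Fubini the coefficient of `f * k` is
`∫ f (g ν) ∫ k x * conj (Y (g x)) dx dg`; the substitution `g ↦ g r` followed by averaging over `r`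
splits it into the product of the coefficients (`coeff_conv`).

*Zonal filters.* The average of a measurable representative of `k` over the stabilizer of the north
pole, with its Haar probability measure, is zonal. It gives the same convolutions because
`f (g ν)` does not see the replacement of `g` by `g h⁻¹` with `h` in the stabilizer
(`conv_zonalAverage`), and the mean value property at `ν` gives its coefficients, since
`Y (ν) = 0` for orders other than zero.
-/

namespace SphericalConv

open MeasureTheory

/-! ### Haar measure of compact groups -/

section CompactGroup

variable {G : Type*} [Group G] [TopologicalSpace G] [IsTopologicalGroup G] [CompactSpace G]
  [MeasurableSpace G] [BorelSpace G]

theorem eq_of_compactSpace_of_measure_univ_eq (μ' μ : Measure G) [μ.IsHaarMeasure]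
    [μ'.IsMulLeftInvariant] [IsFiniteMeasureOnCompacts μ']
    (h : μ' Set.univ = μ Set.univ) : μ' = μ := by
  have h1 := Measure.isMulInvariant_eq_smul_of_compactSpace μ' μ
  have h2 : (Measure.haarScalarFactor μ' μ : ENNReal) * μ Set.univ = 1 * μ Set.univ := by
    have h2 := congrArg (· Set.univ) h1
    simp only [Measure.smul_apply] at h2
    rw [one_mul]
    exact h2.symm.trans h
  have h3 := (ENNReal.mul_left_inj (NeZero.ne _) (measure_ne_top _ _)).1 h2
  rw [ENNReal.coe_eq_one] at h3
  rw [h1, h3, one_smul]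

/-- Compact groups are unimodular: translating a Haar measure on the right does not change its
total mass, so uniqueness of Haar measure applies. -/
theorem isMulRightInvariant_of_compactSpace (μ : Measure G) [μ.IsHaarMeasure] :
    μ.IsMulRightInvariant where
  map_mul_right_eq_self g := by
    have hm : Measurable (· * g) := (continuous_mul_const g).measurable
    have : IsFiniteMeasure (μ.map (· * g)) := Measure.isFiniteMeasure_map μ _
    refine eq_of_compactSpace_of_measure_univ_eq _ _ ?_
    rw [Measure.map_apply hm .univ, Set.preimage_univ]

theorem isInvInvariant_of_compactSpace (μ : Measure G) [μ.IsHaarMeasure] :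
    μ.IsInvInvariant where
  inv_eq_self := by
    have := isMulRightInvariant_of_compactSpace μ
    refine eq_of_compactSpace_of_measure_univ_eq _ _ ?_
    rw [Measure.inv_apply, Set.inv_univ]

end CompactGroup

instance isHaarMeasure_haarSO3 : haarSO3.IsHaarMeasure :=
  Measure.IsHaarMeasure.smul _ (by simp [Real.pi_ne_zero]) ENNReal.ofReal_ne_top

instance : haarSO3.IsMulRightInvariant := isMulRightInvariant_of_compactSpace _

instance : haarSO3.IsInvInvariant := isInvInvariant_of_compactSpace _

theorem haarSO3_univ : haarSO3 Set.univ = ENNReal.ofReal (8 * Real.pi ^ 2) := by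
  have : Measure.haarMeasure (⊤ : TopologicalSpace.PositiveCompacts SO3) Set.univ = 1 := by
    simpa using Measure.haarMeasure_self (K₀ := (⊤ : TopologicalSpace.PositiveCompacts SO3))
  rw [haarSO3, Measure.smul_apply, this, smul_eq_mul, mul_one]

theorem surfaceMeasure_univ : surfaceMeasure Set.univ = ENNReal.ofReal (4 * Real.pi) := by
  rw [surfaceMeasure, Measure.toSphere_apply_univ, EuclideanSpace.volume_ball_fin_three]
  rw [finrank_euclideanSpace_fin, ENNReal.ofReal_one, one_pow, one_mul,
    show ((3 : ℕ) : ENNReal) = ENNReal.ofReal 3 by simp, ← ENNReal.ofReal_mul (by norm_num)]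
  congr 1
  ring

instance : IsFiniteMeasure surfaceMeasure :=
  inferInstanceAs (IsFiniteMeasure (volume : Measure E3).toSphere)

/-! ### The action of rotations on the sphere -/

theorem rotate_one (x : S2) : rotate 1 x = x := by
  ext i
  simp [rotate]

theorem rotate_mul (g h : SO3) (x : S2) : rotate (g * h) x = rotate g (rotate h x) := by
  ext i
  simp [rotate, Matrix.mulVec_mulVec]

theorem rotate_inv_rotate (g : SO3) (x : S2) : rotate g⁻¹ (rotate g x) = x := by
  rw [← rotate_mul, inv_mul_cancel, rotate_one]

theorem rotate_rotate_inv (g : SO3) (x : S2) : rotate g (rotate g⁻¹ x) = x := by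
  rw [← rotate_mul, mul_inv_cancel, rotate_one]

theorem continuous_rotate : Continuous fun p : SO3 × S2 => rotate p.1 p.2 := by
  unfold rotate
  fun_prop

theorem continuous_rotate_left (x : S2) : Continuous fun g : SO3 => rotate g x :=
  continuous_rotate.comp (by fun_prop : Continuous fun g : SO3 => (g, x))

theorem continuous_rotate_right (g : SO3) : Continuous (rotate g) :=
  continuous_rotate.comp (by fun_prop : Continuous fun x : S2 => (g, x))

theorem norm_toEuclideanLin (g : SO3) (v : E3) :
    ‖Matrix.toEuclideanLin (g : Matrix (Fin 3) (Fin 3) ℝ) v‖ = ‖v‖ := by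
  have hg : (g : Matrix (Fin 3) (Fin 3) ℝ).transpose * (g : Matrix (Fin 3) (Fin 3) ℝ) = 1 :=
    (Matrix.mem_orthogonalGroup_iff' (Fin 3) ℝ).1
      (Matrix.mem_specialOrthogonalGroup_iff.1 g.2).1
  have h : ∀ u : E3, ‖u‖ ^ 2 = dotProduct (WithLp.ofLp u) (WithLp.ofLp u) := by
    intro u
    rw [EuclideanSpace.norm_sq_eq]
    simp [dotProduct, sq]
  refine (pow_left_inj₀ (norm_nonneg _) (norm_nonneg _) two_ne_zero).1 ?_
  rw [h, h, Matrix.ofLp_toLpLin, Matrix.toLin'_apply, Matrix.dotProduct_mulVec,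
    ← Matrix.mulVec_transpose, Matrix.mulVec_mulVec, hg, Matrix.one_mulVec]

/-- The rotation `g` as a linear isometry of the ambient space. -/
noncomputable def rotateIsometry (g : SO3) : E3 ≃ₗᵢ[ℝ] E3 :=
  LinearIsometry.toLinearIsometryEquiv
    ⟨Matrix.toEuclideanLin (g : Matrix (Fin 3) (Fin 3) ℝ), norm_toEuclideanLin g⟩ rfl

theorem coe_rotate (g : SO3) (x : S2) : (rotate g x : E3) = rotateIsometry g x := rfl

open scoped Pointwise in
/-- The surface measure is rotation invariant, because the volume of the cone over a subset of the
sphere is. -/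
theorem measurePreserving_rotate (g : SO3) :
    MeasurePreserving (rotate g) surfaceMeasure surfaceMeasure := by
  have hm := (continuous_rotate_right g).measurable
  refine ⟨hm, Measure.ext fun s hs => ?_⟩
  rw [Measure.map_apply hm hs, surfaceMeasure, Measure.toSphere_apply' _ (hm hs),
    Measure.toSphere_apply' _ hs]
  have h : Set.Ioo (0 : ℝ) 1 • (Subtype.val '' (rotate g ⁻¹' s)) =
      rotateIsometry g ⁻¹' (Set.Ioo (0 : ℝ) 1 • (Subtype.val '' s)) := by
    ext v
    simp only [Set.mem_preimage, Set.mem_smul, Set.mem_image]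
    constructor
    · rintro ⟨r, hr, _, ⟨x, hx, rfl⟩, rfl⟩
      exact ⟨r, hr, _, ⟨rotate g x, hx, rfl⟩, by rw [map_smul, coe_rotate]⟩
    · rintro ⟨r, hr, _, ⟨x, hx, rfl⟩, hv⟩
      refine ⟨r, hr, _, ⟨rotate g⁻¹ x, ?_, rfl⟩, (rotateIsometry g).injective ?_⟩
      · rwa [rotate_rotate_inv]
      · rw [map_smul, ← coe_rotate, rotate_rotate_inv, hv]
  rw [h]
  congr 1
  exact (rotateIsometry g).measurePreserving.measure_preimage_emb
    (rotateIsometry g).toHomeomorph.measurableEmbedding _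

theorem sum_sq_coord (x : S2) : (x : E3) 0 ^ 2 + (x : E3) 1 ^ 2 + (x : E3) 2 ^ 2 = 1 := by
  have h : ‖(x : E3)‖ ^ 2 = 1 := by simp
  rw [EuclideanSpace.norm_sq_eq] at h
  simpa [Fin.sum_univ_three] using h

/-- A point of the sphere in terms of the cylindrical coordinates `z` and `φ`. -/
theorem coord_eq (x : S2) :
    (x : E3) 0 = Real.sqrt (1 - (x : E3) 2 ^ 2) * Real.cos (azimuth x) ∧
      (x : E3) 1 = Real.sqrt (1 - (x : E3) 2 ^ 2) * Real.sin (azimuth x) := by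
  have h : Real.sqrt (1 - (x : E3) 2 ^ 2) = ‖(⟨(x : E3) 0, (x : E3) 1⟩ : ℂ)‖ := by
    rw [Complex.norm_eq_sqrt_sq_add_sq]
    congr 1
    linarith [sum_sq_coord x]
  rw [h, azimuth, Complex.norm_mul_cos_arg, Complex.norm_mul_sin_arg]
  exact ⟨rfl, rfl⟩

/-- Rotation by the angle `φ` about the vertical axis. -/
noncomputable def rotZ (φ : ℝ) : SO3 :=
  ⟨!![Real.cos φ, -Real.sin φ, 0; Real.sin φ, Real.cos φ, 0; 0, 0, 1], by
    rw [Matrix.mem_specialOrthogonalGroup_iff, Matrix.mem_orthogonalGroup_iff]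
    constructor
    · have := Real.cos_sq_add_sin_sq φ
      ext i j
      fin_cases i <;> fin_cases j <;>
        simp [Matrix.mul_apply, Fin.sum_univ_three] <;> grind
    · have := Real.cos_sq_add_sin_sq φ
      simp [Matrix.det_fin_three]
      grind⟩

theorem rotate_rotZ_northPole (φ : ℝ) : rotate (rotZ φ) northPole = northPole := by
  ext i
  fin_cases i <;> simp [rotate, rotZ, northPole]

theorem exists_rotate_northPole_eq (x : S2) : ∃ g : SO3, rotate g northPole = x := by
  obtain ⟨h0, h1⟩ := coord_eq x
  have hx := sum_sq_coord x
  set z := (x : E3) 2 with hz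
  set φ := azimuth x
  set s := Real.sqrt (1 - z ^ 2)
  have hs : s ^ 2 = 1 - z ^ 2 := Real.sq_sqrt (by
    nlinarith [sq_nonneg ((x : E3) 0), sq_nonneg ((x : E3) 1)])
  have hφ := Real.cos_sq_add_sin_sq φ
  -- The columns are the unit vectors in the directions of `θ`, `φ` and the radius at `x`.
  refine ⟨⟨!![z * Real.cos φ, -Real.sin φ, s * Real.cos φ;
    z * Real.sin φ, Real.cos φ, s * Real.sin φ; -s, 0, z], ?_⟩, ?_⟩
  · rw [Matrix.mem_specialOrthogonalGroup_iff, Matrix.mem_orthogonalGroup_iff]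
    constructor
    · ext i j
      fin_cases i <;> fin_cases j <;>
        simp [Matrix.mul_apply, Fin.sum_univ_three] <;> grind
    · simp [Matrix.det_fin_three]
      grind
  · ext i
    fin_cases i <;>
      simp [rotate, northPole, h0, h1, hz]

/-- The orbit map of a point of the sphere pushes the Haar measure of the rotation group to a
multiple of the surface measure. Averaging `∫ F (g x) dg` over `x` gives one evaluation; by
transitivity and right invariance this integral does not depend on `x`. -/
theorem map_rotate_haarSO3 (x : S2) :
    haarSO3.map (fun g => rotate g x) = ENNReal.ofReal (2 * Real.pi) • surfaceMeasure := by
  have hm : ∀ x, Measurable fun g => rotate g x := fun x => (continuous_rotate_left x).measurable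
  have hind : ∀ y, haarSO3.map (fun g => rotate g y) = haarSO3.map (fun g => rotate g x) := by
    intro y
    obtain ⟨a, ha⟩ := exists_rotate_northPole_eq x
    obtain ⟨b, hb⟩ := exists_rotate_northPole_eq y
    have hy : y = rotate (b * a⁻¹) x := by
      rw [← hb, ← ha, rotate_mul, rotate_inv_rotate]
    conv_rhs => rw [← map_mul_right_eq_self haarSO3 (b * a⁻¹)]
    rw [Measure.map_map (hm x) (measurable_mul_const _), hy]
    simp only [Function.comp_def, rotate_mul]
  refine Measure.ext fun s hs => ?_
  have hF : Measurable fun p : S2 × SO3 => s.indicator (1 : S2 → ENNReal) (rotate p.2 p.1) :=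
    (measurable_one.indicator hs).comp
      ((continuous_rotate.comp continuous_swap).measurable)
  have h1 : ∫⁻ y, ∫⁻ g, s.indicator 1 (rotate g y) ∂haarSO3 ∂surfaceMeasure =
      haarSO3.map (fun g => rotate g x) s * ENNReal.ofReal (4 * Real.pi) := by
    have : ∀ y, ∫⁻ g, s.indicator 1 (rotate g y) ∂haarSO3 =
        haarSO3.map (fun g => rotate g x) s := by
      intro y
      rw [← hind y, ← lintegral_indicator_one hs,
        lintegral_map (measurable_one.indicator hs) (hm y)]
    simp_rw [this]
    rw [lintegral_const, surfaceMeasure_univ]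
  have h2 : ∫⁻ y, ∫⁻ g, s.indicator 1 (rotate g y) ∂haarSO3 ∂surfaceMeasure =
      surfaceMeasure s * ENNReal.ofReal (8 * Real.pi ^ 2) := by
    rw [lintegral_lintegral_swap hF.aemeasurable]
    have : ∀ g, ∫⁻ y, s.indicator 1 (rotate g y) ∂surfaceMeasure = surfaceMeasure s := by
      intro g
      rw [(measurePreserving_rotate g).lintegral_comp (measurable_one.indicator hs),
        lintegral_indicator_one hs]
    simp_rw [this]
    rw [lintegral_const, haarSO3_univ]
  have h4 : ENNReal.ofReal (4 * Real.pi) ≠ 0 := by simp [Real.pi_pos]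
  rw [h1, show 8 * Real.pi ^ 2 = (2 * Real.pi) * (4 * Real.pi) by ring,
    ENNReal.ofReal_mul (p := 2 * Real.pi) (by positivity), ← mul_assoc,
    ENNReal.mul_left_inj h4 ENNReal.ofReal_ne_top] at h2
  rw [h2, Measure.smul_apply, smul_eq_mul, mul_comm]

theorem map_rotate_inv_haarSO3 (x : S2) :
    haarSO3.map (fun g => rotate g⁻¹ x) = ENNReal.ofReal (2 * Real.pi) • surfaceMeasure := by
  rw [← map_rotate_haarSO3 x]
  conv_rhs => rw [← Measure.map_inv_eq_self haarSO3]
  rw [Measure.map_map (continuous_rotate_left x).measurable measurable_inv]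
  rfl

/-! ### Trinomials and roots of unity -/

open Polynomial in
theorem coeff_trinomial_pow (ℓ : ℕ) (a b c : ℂ) :
    ((C a * X ^ 2 + C c * X + C b) ^ ℓ).coeff ℓ =
      ∑ j ∈ Finset.range (ℓ + 1),
        (if 2 ∣ j then (a * b) ^ (j / 2) * (j.choose (j / 2) : ℂ) else 0) *
          c ^ (ℓ - j) * (ℓ.choose j : ℂ) := by
  have h : C a * X ^ 2 + C c * X + C b = (C a * X ^ 2 + C b) + C c * X := by ring
  rw [h, add_pow, finsetSum_coeff]
  refine Finset.sum_congr rfl fun j hj => ?_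
  have hj' : j ≤ ℓ := by simpa [Nat.lt_succ_iff] using hj
  have h2 : (C a * X ^ 2 + C b) ^ j = expand ℂ 2 ((C a * X + C b) ^ j) := by simp
  rw [mul_pow, ← C_pow, ← C_eq_natCast, coeff_mul_C, ← mul_assoc]
  conv_lhs => rw [← Nat.add_sub_cancel' hj']
  rw [Nat.add_sub_cancel_left, coeff_mul_X_pow, coeff_mul_C, h2, coeff_expand two_pos]
  congr 2
  -- Only even powers of `X` occur in `(a X² + b) ^ j`.
  split_ifs with hd
  · obtain ⟨i, rfl⟩ := hd
    have h4 : (C a * X + C b) ^ (2 * i) = ((X + C b) ^ (2 * i)).comp (C a * X) := by simp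
    rw [h4, comp_C_mul_X_coeff, coeff_X_add_C_pow, Nat.mul_div_cancel_left _ two_pos,
      show 2 * i - i = i by omega, mul_pow]
    ring
  · rfl
  · rw [Nat.add_sub_cancel' hj']

open Polynomial in
/-- The central coefficient of a power of a trinomial does not see how the product of the outer
coefficients is distributed over the two of them. -/
theorem coeff_trinomial_pow_congr (ℓ : ℕ) {a b a' b' : ℂ} (c : ℂ) (h : a * b = a' * b') :
    ((C a * X ^ 2 + C c * X + C b) ^ ℓ).coeff ℓ =
      ((C a' * X ^ 2 + C c * X + C b') ^ ℓ).coeff ℓ := by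
  rw [coeff_trinomial_pow, coeff_trinomial_pow, h]

theorem sum_primitiveRoot_zpow {N : ℕ} {ω : ℂ} (hω : IsPrimitiveRoot ω N) {k : ℤ}
    (hk : |k| < N) :
    ∑ j ∈ Finset.range N, (ω ^ k) ^ j = if k = 0 then (N : ℂ) else 0 := by
  split_ifs with h
  · simp [h]
  · have hne : ω ^ k ≠ 1 := by
      rw [Ne, hω.zpow_eq_one_iff_dvd]
      intro hd
      exact h (Int.eq_zero_of_abs_lt_dvd hd hk)
    rw [geom_sum_eq hne, ← zpow_natCast, ← zpow_mul, mul_comm k, zpow_mul, zpow_natCast,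
      hω.pow_eq_one, one_zpow, sub_self, zero_div]

/-- Averaging `(a u + c + b u⁻¹) ^ ℓ` over the roots of unity of order `ℓ + 1` extracts the term
without `u`. -/
theorem sum_trinomial_primitiveRoot (ℓ : ℕ) {ω : ℂ} (hω : IsPrimitiveRoot ω (ℓ + 1)) (a b c : ℂ) :
    ∑ j ∈ Finset.range (ℓ + 1), (a * ω ^ j + c + b * (ω ^ j)⁻¹) ^ ℓ =
      (ℓ + 1) * ((Polynomial.C a * Polynomial.X ^ 2 + Polynomial.C c * Polynomial.X +
        Polynomial.C b) ^ ℓ).coeff ℓ := by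
  set p : Polynomial ℂ := (Polynomial.C a * Polynomial.X ^ 2 + Polynomial.C c * Polynomial.X +
        Polynomial.C b) ^ ℓ with hp
  have hω0 : ω ≠ 0 := hω.ne_zero (Nat.succ_ne_zero ℓ)
  have hdeg : p.natDegree < 2 * ℓ + 1 := by
    have : p.natDegree ≤ ℓ * 2 :=
      Polynomial.natDegree_pow_le_of_le ℓ Polynomial.natDegree_quadratic_le
    omega
  have h1 : ∀ j, (a * ω ^ j + c + b * (ω ^ j)⁻¹) ^ ℓ =
      ∑ n ∈ Finset.range (2 * ℓ + 1), p.coeff n * (ω ^ ((n : ℤ) - ℓ)) ^ j := by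
    intro j
    have hj : ω ^ j ≠ 0 := pow_ne_zero _ hω0
    have h2 : (a * ω ^ j + c + b * (ω ^ j)⁻¹) ^ ℓ = p.eval (ω ^ j) * ((ω ^ j) ^ ℓ)⁻¹ := by
      rw [hp, Polynomial.eval_pow, ← inv_pow (ω ^ j), ← mul_pow]
      congr 1
      simp
      field_simp
    rw [h2, Polynomial.eval_eq_sum_range' hdeg, Finset.sum_mul]
    refine Finset.sum_congr rfl fun n _ => ?_
    rw [zpow_sub₀ hω0, zpow_natCast, zpow_natCast, div_pow, ← pow_mul, ← pow_mul, ← pow_mul,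
      ← pow_mul, mul_comm j n, mul_comm j ℓ, mul_assoc, div_eq_mul_inv]
  simp_rw [h1]
  rw [Finset.sum_comm]
  simp_rw [← Finset.mul_sum]
  rw [Finset.sum_eq_single_of_mem ℓ (by simp; omega)]
  · simp
    ring
  · intro n hn hne
    have hn' := Finset.mem_range.1 hn
    rw [sum_primitiveRoot_zpow hω (by push_cast; rw [abs_lt]; constructor <;> omega),
      if_neg (by omega), mul_zero]

/-! ### Null linear forms and the generating polynomial -/

/-- The complex-bilinear pairing of a complex vector with a point of the sphere. -/
noncomputable def linForm (b : Fin 3 → ℂ) (x : S2) : ℂ := ∑ i, b i * ((x : E3) i : ℂ)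

theorem linForm_rotate (b : Fin 3 → ℂ) (g : SO3) (x : S2) :
    linForm b (rotate g x) =
      linForm (fun j => ∑ i, b i * ((g : Matrix (Fin 3) (Fin 3) ℝ) i j : ℂ)) x := by
  simp only [linForm, rotate, Matrix.mulVec, dotProduct, Fin.sum_univ_three]
  push_cast
  ring

theorem linForm_northPole (b : Fin 3 → ℂ) : linForm b northPole = b 2 := by
  simp [linForm, northPole, Fin.sum_univ_three]

/-- Rotations preserve the complex quadratic form, hence null vectors. -/
theorem sum_sq_vecMul (b : Fin 3 → ℂ) (g : SO3) :
    ∑ j, (∑ i, b i * ((g : Matrix (Fin 3) (Fin 3) ℝ) i j : ℂ)) ^ 2 = ∑ i, b i ^ 2 := by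
  have hg := (Matrix.mem_orthogonalGroup_iff (Fin 3) ℝ).1
      (Matrix.mem_specialOrthogonalGroup_iff.1 g.2).1
  have h : ∀ i i', ((g : Matrix (Fin 3) (Fin 3) ℝ) i 0 : ℂ) * (g : Matrix (Fin 3) (Fin 3) ℝ) i' 0 +
      (g : Matrix (Fin 3) (Fin 3) ℝ) i 1 * (g : Matrix (Fin 3) (Fin 3) ℝ) i' 1 +
      (g : Matrix (Fin 3) (Fin 3) ℝ) i 2 * (g : Matrix (Fin 3) (Fin 3) ℝ) i' 2 =
      if i = i' then 1 else 0 := by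
    intro i i'
    have h : (g : Matrix (Fin 3) (Fin 3) ℝ) i 0 * (g : Matrix (Fin 3) (Fin 3) ℝ) i' 0 +
        (g : Matrix (Fin 3) (Fin 3) ℝ) i 1 * (g : Matrix (Fin 3) (Fin 3) ℝ) i' 1 +
        (g : Matrix (Fin 3) (Fin 3) ℝ) i 2 * (g : Matrix (Fin 3) (Fin 3) ℝ) i' 2 =
        if i = i' then 1 else 0 := by
      simpa [Matrix.mul_apply, Fin.sum_univ_three, Matrix.one_apply] using
        congrFun (congrFun hg i) i'
    have h' := congrArg ((↑) : ℝ → ℂ) h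
    push_cast at h'
    rw [h']
    split_ifs <;> simp
  have h00 := h 0 0
  have h11 := h 1 1
  have h22 := h 2 2
  have h01 := h 0 1
  have h02 := h 0 2
  have h12 := h 1 2
  simp only [Fin.sum_univ_three]
  simp at h00 h11 h22 h01 h02 h12
  linear_combination b 0 ^ 2 * h00 + b 1 ^ 2 * h11 + b 2 ^ 2 * h22 + 2 * b 0 * b 1 * h01 +
    2 * b 0 * b 2 * h02 + 2 * b 1 * b 2 * h12

/-- The horizontal part of a point of the sphere, as a complex number. -/
noncomputable def horiz (x : S2) : ℂ := ⟨(x : E3) 0, (x : E3) 1⟩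

theorem horiz_eq (x : S2) : horiz x = (x : E3) 0 + (x : E3) 1 * Complex.I :=
  Complex.mk_eq_add_mul_I _ _

theorem conj_horiz (x : S2) :
    (starRingEnd ℂ) (horiz x) = (x : E3) 0 - (x : E3) 1 * Complex.I := by
  simp [horiz_eq, sub_eq_add_neg]

theorem horiz_mul_conj (x : S2) :
    horiz x * (starRingEnd ℂ) (horiz x) = 1 - ((x : E3) 2 : ℂ) ^ 2 := by
  have h : ((x : E3) 0 : ℂ) ^ 2 + ((x : E3) 1 : ℂ) ^ 2 + ((x : E3) 2 : ℂ) ^ 2 = 1 := by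
    have h0 := congrArg ((↑) : ℝ → ℂ) (sum_sq_coord x)
    push_cast at h0
    exact h0
  rw [conj_horiz, horiz_eq]
  linear_combination h - ((x : E3) 1 : ℂ) ^ 2 * Complex.I_sq

/-- The generating polynomial of the spherical harmonics of degree `ℓ` at the point `x`: at `h` it
takes the value `(v · x) ^ ℓ` for a null vector `v` depending quadratically on `h`. -/
noncomputable def genPoly (ℓ : ℕ) (x : S2) : Polynomial ℂ :=
  (Polynomial.C (horiz x / 2) * Polynomial.X ^ 2 + Polynomial.C ((x : E3) 2 : ℂ) * Polynomial.X +
    Polynomial.C (-(starRingEnd ℂ) (horiz x) / 2)) ^ ℓ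

theorem eval_genPoly (ℓ : ℕ) (x : S2) (h : ℂ) :
    (genPoly ℓ x).eval h =
      linForm ![(h ^ 2 - 1) / 2, Complex.I * (h ^ 2 + 1) / 2, h] x ^ ℓ := by
  simp only [genPoly, linForm, Polynomial.eval_pow]
  congr 1
  simp [conj_horiz, Fin.sum_univ_three]
  rw [horiz_eq]
  ring

/-- The zonal function of degree `ℓ`, that is the Legendre polynomial of the height, defined as the
central coefficient of the generating polynomial. -/
noncomputable def zonal (ℓ : ℕ) (x : S2) : ℂ := (genPoly ℓ x).coeff ℓ

open Polynomial in
theorem zonal_eq_coeff (ℓ : ℕ) (x : S2) {a b : ℂ} (h : a * b = (((x : E3) 2 : ℂ) ^ 2 - 1) / 4) :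
    zonal ℓ x = ((C a * X ^ 2 + C ((x : E3) 2 : ℂ) * X + C b) ^ ℓ).coeff ℓ := by
  refine coeff_trinomial_pow_congr ℓ _ ?_
  rw [h]
  linear_combination (-1 / 4 : ℂ) * horiz_mul_conj x

open Polynomial in
/-- The homogeneous form of `zonal_eq_coeff`, for null vectors with vertical component `s`. -/
theorem coeff_trinomial_pow_eq_zonal (ℓ : ℕ) (x : S2) {a b s : ℂ}
    (h : a * b = s ^ 2 * (((x : E3) 2 : ℂ) ^ 2 - 1) / 4) :
    ((C a * X ^ 2 + C (s * ((x : E3) 2 : ℂ)) * X + C b) ^ ℓ).coeff ℓ = s ^ ℓ * zonal ℓ x := by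
  rw [zonal_eq_coeff ℓ x (a := 1 / 2) (b := (((x : E3) 2 : ℂ) ^ 2 - 1) / 2) (by ring),
    ← coeff_C_mul, C_pow, ← mul_pow,
    coeff_trinomial_pow_congr ℓ (a' := s * (1 / 2)) (b' := s * ((((x : E3) 2 : ℂ) ^ 2 - 1) / 2)) _
      (by rw [h]; ring)]
  congr 2
  simp only [C_mul]
  ring

/-- The rotations about the vertical axis by multiples of `2π / (ℓ + 1)`. -/
noncomputable def rotRoot (ℓ j : ℕ) : SO3 := rotZ (j * (2 * Real.pi / (ℓ + 1)))

/-- The mean value property: averaging the power of a null linear form over finitely many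
rotations about the vertical axis gives its value at the pole times the zonal function. -/
theorem sum_linForm_pow_rotRoot (ℓ : ℕ) (b : Fin 3 → ℂ) (hb : ∑ i, b i ^ 2 = 0) (x : S2) :
    ∑ j ∈ Finset.range (ℓ + 1), linForm b (rotate (rotRoot ℓ j) x) ^ ℓ =
      (ℓ + 1) * (b 2 ^ ℓ * zonal ℓ x) := by
  have hω : IsPrimitiveRoot (Complex.exp (2 * Real.pi * Complex.I / ((ℓ + 1 : ℕ) : ℂ))) (ℓ + 1) :=
    Complex.isPrimitiveRoot_exp _ (Nat.succ_ne_zero ℓ)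
  rw [← coeff_trinomial_pow_eq_zonal ℓ x (a := (b 0 - b 1 * Complex.I) * horiz x / 2)
    (b := (b 0 + b 1 * Complex.I) * (starRingEnd ℂ) (horiz x) / 2),
    ← sum_trinomial_primitiveRoot ℓ hω]
  · refine Finset.sum_congr rfl fun j _ => ?_
    congr 1
    set φ : ℝ := j * (2 * Real.pi / (ℓ + 1)) with hφ
    have h1 : Complex.exp (2 * Real.pi * Complex.I / ((ℓ + 1 : ℕ) : ℂ)) ^ j =
        Real.cos φ + Real.sin φ * Complex.I := by
      rw [← Complex.exp_nat_mul, Complex.ofReal_cos, Complex.ofReal_sin, ← Complex.exp_mul_I, hφ]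
      congr 1
      push_cast
      ring
    have h2 : (Real.cos φ : ℂ) ^ 2 + (Real.sin φ : ℂ) ^ 2 = 1 := by
      exact_mod_cast Real.cos_sq_add_sin_sq φ
    have h3 : ((Real.cos φ : ℂ) + Real.sin φ * Complex.I)⁻¹ =
        Real.cos φ - Real.sin φ * Complex.I := by
      refine inv_eq_of_mul_eq_one_right ?_
      linear_combination h2 - (Real.sin φ : ℂ) ^ 2 * Complex.I_sq
    rw [h1, h3, conj_horiz, horiz_eq]
    have e : linForm b (rotate (rotRoot ℓ j) x) =
        b 0 * (Real.cos φ * (x : E3) 0 - Real.sin φ * (x : E3) 1) +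
        b 1 * (Real.sin φ * (x : E3) 0 + Real.cos φ * (x : E3) 1) + b 2 * (x : E3) 2 := by
      have e0 : (rotate (rotRoot ℓ j) x : E3) 0 =
          Real.cos φ * (x : E3) 0 - Real.sin φ * (x : E3) 1 := by
        simp [rotRoot, rotate, rotZ, ← hφ, sub_eq_add_neg, Matrix.vecHead, Matrix.vecTail]
      have e1 : (rotate (rotRoot ℓ j) x : E3) 1 =
          Real.sin φ * (x : E3) 0 + Real.cos φ * (x : E3) 1 := by
        simp [rotRoot, rotate, rotZ, ← hφ, Matrix.vecHead, Matrix.vecTail]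
      have e2 : (rotate (rotRoot ℓ j) x : E3) 2 = (x : E3) 2 := by
        simp [rotRoot, rotate, rotZ, Matrix.vecHead, Matrix.vecTail]
      rw [linForm, Fin.sum_univ_three, e0, e1, e2]
      push_cast
      ring
    rw [e]
    linear_combination (b 1 * (Real.sin φ * (x : E3) 0 + Real.cos φ * (x : E3) 1) -
      b 0 * Real.sin φ * (x : E3) 1) * Complex.I_sq
  · rw [Fin.sum_univ_three] at hb
    linear_combination (1 / 4 : ℂ) * (b 0 ^ 2 - b 1 ^ 2 * Complex.I ^ 2) * horiz_mul_conj x +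
      (1 / 4 : ℂ) * (1 - ((x : E3) 2 : ℂ) ^ 2) * (hb - b 1 ^ 2 * Complex.I_sq)

/-- The mean value property at all `h` simultaneously: rotations preserve null vectors, so
`sum_linForm_pow_rotRoot` applies to the linear form of `h` composed with `g`. -/
theorem sum_genPoly_rotRoot (ℓ : ℕ) (g : SO3) (x : S2) :
    ∑ j ∈ Finset.range (ℓ + 1), genPoly ℓ (rotate (g * rotRoot ℓ j) x) =
      Polynomial.C ((ℓ + 1) * zonal ℓ x) * genPoly ℓ (rotate g northPole) := by
  refine Polynomial.funext fun h => ?_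
  rw [Polynomial.eval_finsetSum, Polynomial.eval_mul, Polynomial.eval_C]
  simp_rw [eval_genPoly, rotate_mul, linForm_rotate _ g]
  rw [sum_linForm_pow_rotRoot, linForm_northPole]
  · ring
  · rw [sum_sq_vecMul]
    simp [Fin.sum_univ_three]
    ring_nf
    simp only [Complex.I_sq]
    ring

/-! ### Spherical harmonics as coefficients of the generating polynomial -/

/-- The constant relating spherical harmonics to the coefficients of the generating polynomial. -/
noncomputable def harmonicConst (ℓ : ℕ) (m : ℤ) : ℂ :=
  (Real.sqrt ((2 * ℓ + 1) / (4 * Real.pi) *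
      ((((ℓ : ℤ) - m).toNat.factorial : ℝ) / (((ℓ : ℤ) + m).toNat.factorial : ℝ))) : ℂ) *
    ((-1) ^ (((ℓ : ℤ) + m).toNat + ℓ) * (((ℓ : ℤ) + m).toNat.factorial : ℂ) / (ℓ.factorial : ℂ))

/-- The Taylor coefficient of order `n` of `(X² - 1) ^ ℓ` at the point `z`. -/
noncomputable def taylorCoeff (ℓ n : ℕ) (z : ℝ) : ℝ :=
  (Polynomial.taylor z ((Polynomial.X ^ 2 - 1) ^ ℓ)).coeff n

theorem eval_iterate_derivative (ℓ n : ℕ) (z : ℝ) :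
    (Polynomial.derivative^[n] ((1 - Polynomial.X ^ 2) ^ ℓ : Polynomial ℝ)).eval z =
      (-1) ^ ℓ * n.factorial * taylorCoeff ℓ n z := by
  have h : (1 - Polynomial.X ^ 2 : Polynomial ℝ) ^ ℓ =
      Polynomial.C ((-1) ^ ℓ) * (Polynomial.X ^ 2 - 1) ^ ℓ := by
    rw [Polynomial.C_pow, ← mul_pow]
    congr 1
    simp
  rw [h, Polynomial.iterate_derivative_C_mul, Polynomial.eval_mul, Polynomial.eval_C,
    ← Polynomial.factorial_smul_hasseDeriv, taylorCoeff, Polynomial.taylor_coeff]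
  simp [mul_assoc]

open Polynomial in
theorem map_taylor (ℓ : ℕ) (z : ℝ) :
    (taylor z ((X ^ 2 - 1) ^ ℓ)).map Complex.ofRealHom =
      (C 1 * X ^ 2 + C (2 * z : ℂ) * X + C ((z : ℂ) ^ 2 - 1)) ^ ℓ := by
  simp only [taylor_apply, pow_comp, sub_comp, X_comp, one_comp, Polynomial.map_pow,
    Polynomial.map_sub, Polynomial.map_add, map_X, map_C, Polynomial.map_one]
  congr 1
  simp [show (C 2 : ℂ[X]) = 2 from rfl]
  ring

theorem zonal_eq_taylorCoeff (ℓ : ℕ) (x : S2) :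
    zonal ℓ x = taylorCoeff ℓ ℓ ((x : E3) 2) / 2 ^ ℓ := by
  have h := coeff_trinomial_pow_eq_zonal ℓ x (a := 1) (b := ((x : E3) 2 : ℂ) ^ 2 - 1) (s := 2)
    (by ring)
  rw [← map_taylor, Polynomial.coeff_map] at h
  rw [eq_div_iff (pow_ne_zero _ two_ne_zero), mul_comm, ← h]
  rfl

open Polynomial in
/-- Away from the poles, multiplying by `(2 w) ^ ℓ` and using `1 - z² = w * conj w` turns the
generating polynomial into the Taylor expansion of `(X² - 1) ^ ℓ` at `z`, evaluated at `w h`. -/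
theorem coeff_genPoly_of_horiz_ne_zero (ℓ n : ℕ) (x : S2) (hx : horiz x ≠ 0) :
    (genPoly ℓ x).coeff n =
      horiz x ^ ((n : ℤ) - ℓ) * taylorCoeff ℓ n ((x : E3) 2) / 2 ^ ℓ := by
  have h : C ((2 * horiz x) ^ ℓ) * genPoly ℓ x =
      ((taylor ((x : E3) 2) ((X ^ 2 - 1) ^ ℓ)).map Complex.ofRealHom).comp (C (horiz x) * X) := by
    rw [map_taylor, genPoly, C_pow, ← mul_pow, pow_comp]
    congr 1
    have h1 : (((x : E3) 2 : ℂ) ^ 2 - 1) = 2 * horiz x * (-(starRingEnd ℂ) (horiz x) / 2) := by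
      linear_combination horiz_mul_conj x
    rw [h1]
    have h2 : C (horiz x) = C 2 * C (horiz x / 2) := by
      rw [← C_mul]
      congr 1
      ring
    simp only [add_comp, mul_comp, C_comp, X_pow_comp, X_comp, C_mul, mul_add, C_1, one_mul]
    rw [h2]
    have h3 : (C 2 : ℂ[X]) = 2 := rfl
    rw [h3]
    ring
  have h2 := congrArg (fun p => p.coeff n) h
  simp only [coeff_C_mul, comp_C_mul_X_coeff, coeff_map] at h2
  rw [zpow_sub₀ hx, zpow_natCast, zpow_natCast, div_mul_eq_mul_div, div_div,
    eq_div_iff (mul_ne_zero (pow_ne_zero _ hx) (pow_ne_zero _ two_ne_zero))]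
  rw [mul_pow] at h2
  change _ = (taylorCoeff ℓ n ((x : E3) 2) : ℂ) * _ at h2
  linear_combination h2

theorem sub_sq_eq_norm_horiz_sq (x : S2) : 1 - (x : E3) 2 ^ 2 = ‖horiz x‖ ^ 2 := by
  rw [Complex.sq_norm, horiz, Complex.normSq_mk]
  linarith [sum_sq_coord x]

theorem cos_polar (x : S2) : Real.cos (polar x) = (x : E3) 2 := by
  have h := sub_sq_eq_norm_horiz_sq x
  have h1 : (x : E3) 2 ^ 2 ≤ 1 := by linarith [sq_nonneg ‖horiz x‖]
  rw [sq_le_one_iff_abs_le_one, abs_le] at h1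
  exact Real.cos_arccos h1.1 h1.2

theorem norm_zpow_mul_exp_arg (w : ℂ) (m : ℤ) :
    ((‖w‖ ^ m : ℝ) : ℂ) * Complex.exp (Complex.I * m * w.arg) = w ^ m := by
  conv_rhs => rw [← Complex.norm_mul_exp_arg_mul_I w]
  rw [mul_zpow, ← Complex.exp_int_mul]
  push_cast
  congr 2
  ring

theorem coeff_genPoly_of_horiz_eq_zero (ℓ n : ℕ) (x : S2) (hx : horiz x = 0) :
    (genPoly ℓ x).coeff n = if n = ℓ then ((x : E3) 2 : ℂ) ^ ℓ else 0 := by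
  have h : genPoly ℓ x = Polynomial.C (((x : E3) 2 : ℂ) ^ ℓ) * Polynomial.X ^ ℓ := by
    rw [genPoly, hx, Polynomial.C_pow]
    simp [mul_pow]
  rw [h, Polynomial.coeff_C_mul_X_pow]

/-- The factors of the spherical harmonic depending on `x` combine to a coefficient of the
generating polynomial: `(1 - z²) ^ (m / 2) * e ^ (i m φ)` is the power `w ^ m` of the horizontal
part `w`, and the powers of `w` come from rescaling the variable of a Taylor expansion. -/
theorem rpow_mul_taylorCoeff_mul_exp (ℓ n : ℕ) (x : S2) :
    (((1 - (x : E3) 2 ^ 2) ^ ((((n : ℤ) - ℓ : ℤ) : ℝ) / 2) : ℝ) : ℂ) *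
        taylorCoeff ℓ n ((x : E3) 2) *
        Complex.exp (Complex.I * ((n : ℤ) - ℓ : ℤ) * azimuth x) =
      2 ^ ℓ * (genPoly ℓ x).coeff n := by
  by_cases hw : horiz x = 0
  · by_cases hn : n = ℓ
    · subst hn
      have h := zonal_eq_taylorCoeff n x
      rw [eq_div_iff (pow_ne_zero _ two_ne_zero), zonal] at h
      simp [← h, mul_comm]
    · have hm : ((((n : ℤ) - ℓ : ℤ) : ℝ) / 2) ≠ 0 := by
        refine div_ne_zero (Int.cast_ne_zero.2 ?_) two_ne_zero
        omega
      have hc : (genPoly ℓ x).coeff n = 0 := by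
        rw [coeff_genPoly_of_horiz_eq_zero ℓ n x hw, if_neg hn]
      -- At the poles both sides vanish; `m / 2` may be negative, where `0 ^ (m / 2) = 0` too.
      rw [hc, sub_sq_eq_norm_horiz_sq, hw, norm_zero, zero_pow two_ne_zero, Real.zero_rpow hm]
      simp
  · rw [coeff_genPoly_of_horiz_ne_zero ℓ n x hw, ← norm_zpow_mul_exp_arg, sub_sq_eq_norm_horiz_sq,
      ← Real.rpow_natCast, ← Real.rpow_mul (norm_nonneg _)]
    have h2 : ((2 : ℕ) : ℝ) * ((((n : ℤ) - ℓ : ℤ) : ℝ) / 2) = (((n : ℤ) - ℓ : ℤ) : ℝ) := by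
      push_cast
      ring
    rw [h2, Real.rpow_intCast]
    have h3 : azimuth x = (horiz x).arg := rfl
    rw [h3]
    field_simp

theorem sphericalHarmonic_eq (ℓ : ℕ) (m : ℤ) (hm : |m| ≤ (ℓ : ℤ)) (x : S2) :
    sphericalHarmonic ℓ m x =
      harmonicConst ℓ m * (genPoly ℓ x).coeff ((ℓ : ℤ) + m).toNat := by
  obtain ⟨n, hn⟩ : ∃ n : ℕ, (n : ℤ) = ℓ + m :=
    ⟨((ℓ : ℤ) + m).toNat, Int.toNat_of_nonneg (by linarith [(abs_le.1 hm).1])⟩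
  obtain rfl : m = (n : ℤ) - ℓ := by omega
  have h := rpow_mul_taylorCoeff_mul_exp ℓ n x
  have hto : ((ℓ : ℤ) + ((n : ℤ) - ℓ)).toNat = n := by omega
  have hf : (ℓ.factorial : ℂ) ≠ 0 := by exact_mod_cast ℓ.factorial_ne_zero
  have h2 : (2 : ℂ) ^ ℓ ≠ 0 := pow_ne_zero _ two_ne_zero
  rw [sphericalHarmonic, harmonicAngle, assocLegendre, harmonicConst, cos_polar,
    eval_iterate_derivative, hto]
  generalize (1 - (x : E3) 2 ^ 2) ^ ((((n : ℤ) - ℓ : ℤ) : ℝ) / 2) = R at h ⊢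
  generalize taylorCoeff ℓ n ((x : E3) 2) = τ at h ⊢
  generalize Complex.exp (Complex.I * ((n : ℤ) - ℓ : ℤ) * azimuth x) = E at h ⊢
  rw [mul_comm (2 ^ ℓ), ← div_eq_iff h2] at h
  rw [← h, pow_add]
  push_cast
  field_simp

theorem continuous_horiz : Continuous horiz := by
  have : horiz = fun x : S2 => ((x : E3) 0 : ℂ) + (x : E3) 1 * Complex.I := funext horiz_eq
  rw [this]
  fun_prop

theorem continuous_coeff_genPoly (ℓ n : ℕ) : Continuous fun x => (genPoly ℓ x).coeff n := by
  have h1 : ∀ n, Continuous fun x : S2 =>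
      (Polynomial.C (horiz x / 2) * Polynomial.X ^ 2 +
        Polynomial.C ((x : E3) 2 : ℂ) * Polynomial.X +
        Polynomial.C (-(starRingEnd ℂ) (horiz x) / 2)).coeff n := by
    intro n
    have := continuous_horiz
    have := Complex.continuous_conj.comp continuous_horiz
    simp only [Polynomial.coeff_add, Polynomial.coeff_C_mul, Polynomial.coeff_C]
    refine (((by fun_prop : Continuous fun x => horiz x / 2).mul continuous_const).add
      (by fun_prop)).add ?_
    split_ifs
    · exact this.neg.div_const _
    · exact continuous_const
  unfold genPoly
  induction ℓ generalizing n with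
  | zero => simpa using continuous_const
  | succ ℓ ih =>
    simp only [pow_succ, Polynomial.coeff_mul]
    exact continuous_finsetSum _ fun p _ => (ih p.1).mul (h1 p.2)

theorem continuous_zonal (ℓ : ℕ) : Continuous (zonal ℓ) := continuous_coeff_genPoly ℓ ℓ

theorem continuous_sphericalHarmonic (ℓ : ℕ) (m : ℤ) (hm : |m| ≤ (ℓ : ℤ)) :
    Continuous (sphericalHarmonic ℓ m) := by
  rw [funext (sphericalHarmonic_eq ℓ m hm)]
  exact continuous_const.mul (continuous_coeff_genPoly _ _)

/-! ### Properties of spherical harmonics -/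

/-- The mean value property of spherical harmonics around the point `g ν`. -/
theorem sum_sphericalHarmonic_rotRoot (ℓ : ℕ) (m : ℤ) (hm : |m| ≤ (ℓ : ℤ)) (g : SO3) (x : S2) :
    ∑ j ∈ Finset.range (ℓ + 1), sphericalHarmonic ℓ m (rotate (g * rotRoot ℓ j) x) =
      (ℓ + 1) * (sphericalHarmonic ℓ m (rotate g northPole) * zonal ℓ x) := by
  simp_rw [sphericalHarmonic_eq ℓ m hm]
  rw [← Finset.mul_sum, ← Polynomial.finsetSum_coeff, sum_genPoly_rotRoot, Polynomial.coeff_C_mul]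
  ring

theorem harmonicConst_zero (ℓ : ℕ) :
    harmonicConst ℓ 0 = Real.sqrt ((2 * ℓ + 1) / (4 * Real.pi)) := by
  have hf : (ℓ.factorial : ℂ) ≠ 0 := by exact_mod_cast ℓ.factorial_ne_zero
  have hf' : (ℓ.factorial : ℝ) ≠ 0 := by exact_mod_cast ℓ.factorial_ne_zero
  simp only [harmonicConst, sub_zero, add_zero, Int.toNat_natCast, div_self hf', mul_one]
  rw [← two_mul, pow_mul]
  simp [hf]

theorem sphericalHarmonic_zero (ℓ : ℕ) (x : S2) :
    sphericalHarmonic ℓ 0 x = Real.sqrt ((2 * ℓ + 1) / (4 * Real.pi)) * zonal ℓ x := by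
  rw [sphericalHarmonic_eq ℓ 0 (by simp), harmonicConst_zero]
  simp [zonal]

theorem conj_zonal (ℓ : ℕ) (x : S2) : (starRingEnd ℂ) (zonal ℓ x) = zonal ℓ x := by
  rw [zonal_eq_taylorCoeff]
  simp [map_ofNat]

theorem coeff_genPoly_northPole (ℓ n : ℕ) :
    (genPoly ℓ northPole).coeff n = if n = ℓ then 1 else 0 := by
  have h : horiz northPole = 0 := by simp [horiz_eq, northPole]
  rw [coeff_genPoly_of_horiz_eq_zero ℓ n _ h]
  simp [northPole]

theorem sphericalHarmonic_northPole (ℓ : ℕ) (m : ℤ) (hm : |m| ≤ (ℓ : ℤ)) (h0 : m ≠ 0) :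
    sphericalHarmonic ℓ m northPole = 0 := by
  have h := abs_le.1 hm
  rw [sphericalHarmonic_eq ℓ m hm, coeff_genPoly_northPole, if_neg, mul_zero]
  omega

/-! ### Integration over rotations -/

theorem measurableEmbedding_rotate (g : SO3) : MeasurableEmbedding (rotate g) :=
  (continuous_rotate_right g).measurableEmbedding fun x y h => by
    rw [← rotate_inv_rotate g x, h, rotate_inv_rotate]

theorem integral_comp_rotate {E : Type*} [NormedAddCommGroup E] [NormedSpace ℝ E]
    (g : SO3) (F : S2 → E) :
    ∫ x, F (rotate g x) ∂surfaceMeasure = ∫ x, F x ∂surfaceMeasure :=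
  (measurePreserving_rotate g).integral_comp (measurableEmbedding_rotate g) F

theorem integral_rotate_haarSO3 {E : Type*} [NormedAddCommGroup E] [NormedSpace ℝ E]
    {F : S2 → E} (hF : AEStronglyMeasurable F surfaceMeasure) (x : S2) :
    ∫ g, F (rotate g x) ∂haarSO3 = (2 * Real.pi) • ∫ y, F y ∂surfaceMeasure := by
  have hF' : AEStronglyMeasurable F (haarSO3.map fun g => rotate g x) := by
    rw [map_rotate_haarSO3]
    exact hF.smul_measure _
  rw [← integral_map (continuous_rotate_left x).aemeasurable hF', map_rotate_haarSO3,
    integral_smul_measure, ENNReal.toReal_ofReal (by positivity)]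

theorem integral_rotate_inv_haarSO3 {E : Type*} [NormedAddCommGroup E] [NormedSpace ℝ E]
    {F : S2 → E} (hF : AEStronglyMeasurable F surfaceMeasure) (x : S2) :
    ∫ g, F (rotate g⁻¹ x) ∂haarSO3 = (2 * Real.pi) • ∫ y, F y ∂surfaceMeasure := by
  rw [← integral_rotate_haarSO3 hF x, ← integral_inv_eq_self _ haarSO3]
  simp_rw [inv_inv]

theorem memLp_comp_rotate {f : S2 → ℂ} (hf : MemLp f 2 surfaceMeasure) (x : S2) :
    MemLp (fun g => f (rotate g x)) 2 haarSO3 := by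
  refine MemLp.comp_of_map (f := fun g => rotate g x) ?_ (continuous_rotate_left x).aemeasurable
  rw [map_rotate_haarSO3]
  exact hf.smul_measure ENNReal.ofReal_ne_top

theorem memLp_comp_rotate_inv {f : S2 → ℂ} (hf : MemLp f 2 surfaceMeasure) (x : S2) :
    MemLp (fun g => f (rotate g⁻¹ x)) 2 haarSO3 := by
  have hm : Continuous fun g : SO3 => rotate g⁻¹ x :=
    (continuous_rotate_left x).comp continuous_inv
  refine MemLp.comp_of_map (f := fun g => rotate g⁻¹ x) ?_ hm.aemeasurable
  rw [map_rotate_inv_haarSO3]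
  exact hf.smul_measure ENNReal.ofReal_ne_top

theorem integrable_conv_integrand {f k : S2 → ℂ} (hf : MemLp f 2 surfaceMeasure)
    (hk : MemLp k 2 surfaceMeasure) (x : S2) :
    Integrable (fun g => f (rotate g northPole) * k (rotate g⁻¹ x)) haarSO3 :=
  (memLp_comp_rotate hf northPole).integrable_mul (memLp_comp_rotate_inv hk x)

/-- The convolution is insensitive, at every point, to modifications of the functions on null
sets. -/
theorem conv_congr_ae {f f' k k' : S2 → ℂ} (hf : f =ᵐ[surfaceMeasure] f')
    (hk : k =ᵐ[surfaceMeasure] k') : conv f k = conv f' k' := by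
  funext x
  have hm : Continuous fun g : SO3 => rotate g⁻¹ x :=
    (continuous_rotate_left x).comp continuous_inv
  have h1 : ∀ᵐ g ∂haarSO3, f (rotate g northPole) = f' (rotate g northPole) := by
    refine ae_of_ae_map (p := fun y => f y = f' y)
      (continuous_rotate_left northPole).aemeasurable ?_
    rw [map_rotate_haarSO3]
    exact Measure.ae_smul_measure hf _
  have h2 : ∀ᵐ g ∂haarSO3, k (rotate g⁻¹ x) = k' (rotate g⁻¹ x) := by
    refine ae_of_ae_map (f := fun g => rotate g⁻¹ x) (p := fun y => k y = k' y) hm.aemeasurable ?_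
    rw [map_rotate_inv_haarSO3]
    exact Measure.ae_smul_measure hk _
  refine integral_congr_ae ?_
  filter_upwards [h1, h2] with g hg1 hg2
  rw [hg1, hg2]

theorem coeff_congr_ae {f f' : S2 → ℂ} (hf : f =ᵐ[surfaceMeasure] f') (ℓ : ℕ) (m : ℤ) :
    coeff f ℓ m = coeff f' ℓ m := by
  refine integral_congr_ae ?_
  filter_upwards [hf] with x hx
  rw [hx]

theorem integral_norm_mul_le {f k : S2 → ℂ} (hf : MemLp f 2 surfaceMeasure)
    (hk : MemLp k 2 surfaceMeasure) (x : S2) :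
    ∫ g, ‖f (rotate g northPole) * k (rotate g⁻¹ x)‖ ∂haarSO3 ≤
      2 * Real.pi * (∫ y, ‖f y‖ ^ 2 ∂surfaceMeasure + ∫ y, ‖k y‖ ^ 2 ∂surfaceMeasure) := by
  have h1 := (memLp_comp_rotate hf northPole).norm.integrable_sq
  have h2 := (memLp_comp_rotate_inv hk x).norm.integrable_sq
  refine (integral_mono (integrable_conv_integrand hf hk x).norm (h1.add h2) fun g => ?_).trans ?_
  · simp only [norm_mul, Pi.add_apply]
    nlinarith [sq_nonneg (‖f (rotate g northPole)‖ - ‖k (rotate g⁻¹ x)‖),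
      sq_nonneg ‖f (rotate g northPole)‖, sq_nonneg ‖k (rotate g⁻¹ x)‖]
  · simp only [Pi.add_apply]
    rw [integral_add h1 h2,
      integral_rotate_haarSO3 (F := fun y => ‖f y‖ ^ 2) (hf.1.norm.pow 2) northPole,
      integral_rotate_inv_haarSO3 (F := fun y => ‖k y‖ ^ 2) (hk.1.norm.pow 2) x, ← smul_add,
      smul_eq_mul]

/-- A version of Tonelli's criterion: a measurable function is integrable over a product if its
sections have uniformly bounded integrals. -/
theorem integrable_prod_of_section_bound {α β E : Type*} [MeasurableSpace α] [MeasurableSpace β]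
    [NormedAddCommGroup E] {μ : Measure α} [IsFiniteMeasure μ] {μ' : Measure β} [SFinite μ']
    {F : α × β → E} (hF : StronglyMeasurable F)
    (hint : ∀ a, Integrable (fun b => F (a, b)) μ') (C : ℝ)
    (hC : ∀ a, ∫ b, ‖F (a, b)‖ ∂μ' ≤ C) : Integrable F (μ.prod μ') := by
  rw [integrable_prod_iff hF.aestronglyMeasurable]
  refine ⟨.of_forall hint, Integrable.of_bound
    hF.norm.integral_prod_right.aestronglyMeasurable C (.of_forall fun a => ?_)⟩
  rw [Real.norm_of_nonneg (integral_nonneg fun b => norm_nonneg _)]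
  exact hC a

theorem stronglyMeasurable_conv_integrand {f k : S2 → ℂ} (hf : StronglyMeasurable f)
    (hk : StronglyMeasurable k) :
    StronglyMeasurable fun p : S2 × SO3 =>
      f (rotate p.2 northPole) * k (rotate p.2⁻¹ p.1) := by
  refine (hf.comp_measurable ?_).mul (hk.comp_measurable ?_)
  · exact ((continuous_rotate_left northPole).comp continuous_snd).measurable
  · exact (continuous_rotate.comp
      (by fun_prop : Continuous fun p : S2 × SO3 => (p.2⁻¹, p.1))).measurable

theorem memLp_conv {f k : S2 → ℂ} (hf : MemLp f 2 surfaceMeasure)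
    (hk : MemLp k 2 surfaceMeasure) : MemLp (conv f k) 2 surfaceMeasure := by
  rw [conv_congr_ae hf.1.ae_eq_mk hk.1.ae_eq_mk]
  have hf' := (memLp_congr_ae hf.1.ae_eq_mk).1 hf
  have hk' := (memLp_congr_ae hk.1.ae_eq_mk).1 hk
  exact MemLp.of_bound
    (stronglyMeasurable_conv_integrand hf.1.stronglyMeasurable_mk
      hk.1.stronglyMeasurable_mk).integral_prod_right.aestronglyMeasurable _
    (.of_forall fun x => (norm_integral_le_integral_norm _).trans (integral_norm_mul_le hf' hk' x))

/-! ### The convolution theorem -/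

theorem exists_norm_sphericalHarmonic_le (ℓ : ℕ) (m : ℤ) (hm : |m| ≤ (ℓ : ℤ)) :
    ∃ B, ∀ x, ‖sphericalHarmonic ℓ m x‖ ≤ B := by
  obtain ⟨B, hB⟩ := isCompact_univ.exists_bound_of_continuousOn
    (continuous_sphericalHarmonic ℓ m hm).continuousOn
  exact ⟨B, fun x => hB x trivial⟩

theorem integrable_mul_conj_sphericalHarmonic {k : S2 → ℂ} (hk : Integrable k surfaceMeasure)
    (ℓ : ℕ) (m : ℤ) (hm : |m| ≤ (ℓ : ℤ)) (g : SO3) :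
    Integrable (fun x => k x * (starRingEnd ℂ) (sphericalHarmonic ℓ m (rotate g x)))
      surfaceMeasure := by
  obtain ⟨B, hB⟩ := exists_norm_sphericalHarmonic_le ℓ m hm
  refine hk.mul_bdd (c := B) (Complex.continuous_conj.comp
    ((continuous_sphericalHarmonic ℓ m hm).comp
      (continuous_rotate_right g))).aestronglyMeasurable (.of_forall fun x => ?_)
  simpa using hB (rotate g x)

/-- The mean value property, integrated against a function on the sphere. -/
theorem sum_integral_mul_conj_sphericalHarmonic {k : S2 → ℂ} (hk : Integrable k surfaceMeasure)
    (ℓ : ℕ) (m : ℤ) (hm : |m| ≤ (ℓ : ℤ)) (g : SO3) :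
    ∑ j ∈ Finset.range (ℓ + 1),
        ∫ x, k x * (starRingEnd ℂ) (sphericalHarmonic ℓ m (rotate (g * rotRoot ℓ j) x))
          ∂surfaceMeasure =
      (ℓ + 1) * ((starRingEnd ℂ) (sphericalHarmonic ℓ m (rotate g northPole)) *
        ∫ x, k x * zonal ℓ x ∂surfaceMeasure) := by
  rw [← integral_finsetSum _ fun j _ => integrable_mul_conj_sphericalHarmonic hk ℓ m hm _,
    ← integral_const_mul, ← integral_const_mul]
  refine integral_congr_ae (.of_forall fun x => ?_)
  simp only
  rw [← Finset.mul_sum, ← map_sum, sum_sphericalHarmonic_rotRoot ℓ m hm]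
  simp only [map_mul, map_add, map_natCast, map_one, conj_zonal]
  ring

theorem coeff_zero_eq (k : S2 → ℂ) (ℓ : ℕ) :
    coeff k ℓ 0 =
      Real.sqrt ((2 * ℓ + 1) / (4 * Real.pi)) * ∫ x, k x * zonal ℓ x ∂surfaceMeasure := by
  rw [coeff, ← integral_const_mul]
  refine integral_congr_ae (.of_forall fun x => ?_)
  simp only [sphericalHarmonic_zero, map_mul, Complex.conj_ofReal, conj_zonal]
  ring

/-- Testing a convolution against a bounded function: Fubini, and rotation of the sphere for each
fixed rotation. -/
theorem integral_conv_mul {f k Y : S2 → ℂ} (hf : MemLp f 2 surfaceMeasure)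
    (hk : MemLp k 2 surfaceMeasure) (hfm : StronglyMeasurable f) (hkm : StronglyMeasurable k)
    (hY : StronglyMeasurable Y) (B : ℝ) (hB : ∀ x, ‖Y x‖ ≤ B) :
    Integrable (fun g => f (rotate g northPole) *
      ∫ x, k x * Y (rotate g x) ∂surfaceMeasure) haarSO3 ∧
    ∫ x, conv f k x * Y x ∂surfaceMeasure = ∫ g, f (rotate g northPole) *
      ∫ x, k x * Y (rotate g x) ∂surfaceMeasure ∂haarSO3 := by
  have hFm : StronglyMeasurable fun p : S2 × SO3 =>
      f (rotate p.2 northPole) * k (rotate p.2⁻¹ p.1) * Y p.1 :=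
    (stronglyMeasurable_conv_integrand hfm hkm).mul (hY.comp_measurable measurable_fst)
  have hFb : ∀ x, ∫ g, ‖f (rotate g northPole) * k (rotate g⁻¹ x) * Y x‖ ∂haarSO3 ≤
      2 * Real.pi * (∫ y, ‖f y‖ ^ 2 ∂surfaceMeasure + ∫ y, ‖k y‖ ^ 2 ∂surfaceMeasure) * B := by
    intro x
    simp_rw [norm_mul _ (Y x)]
    rw [integral_mul_const]
    exact mul_le_mul (integral_norm_mul_le hf hk x) (hB x) (norm_nonneg _) (by positivity)
  have hFi : Integrable (fun p : S2 × SO3 =>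
      f (rotate p.2 northPole) * k (rotate p.2⁻¹ p.1) * Y p.1)
      (surfaceMeasure.prod haarSO3) :=
    integrable_prod_of_section_bound hFm
      (fun x => (integrable_conv_integrand hf hk x).mul_const (Y x)) _ hFb
  have hA : ∀ g, ∫ x, f (rotate g northPole) * k (rotate g⁻¹ x) * Y x ∂surfaceMeasure =
      f (rotate g northPole) * ∫ x, k x * Y (rotate g x) ∂surfaceMeasure := by
    intro g
    rw [← integral_const_mul, ← integral_comp_rotate g]
    refine integral_congr_ae (.of_forall fun x => ?_)
    simp only [rotate_inv_rotate]
    ring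
  constructor
  · simpa only [hA] using hFi.integral_prod_right
  · simp_rw [← hA]
    rw [← integral_integral_swap hFi]
    simp only [conv, integral_mul_const]

theorem coeff_conv {f k : S2 → ℂ} (hf : MemLp f 2 surfaceMeasure)
    (hk : MemLp k 2 surfaceMeasure) (ℓ : ℕ) (m : ℤ) (hm : |m| ≤ (ℓ : ℤ)) :
    coeff (conv f k) ℓ m =
      2 * (Real.pi : ℂ) * (Real.sqrt (4 * Real.pi / (2 * (ℓ : ℝ) + 1)) : ℂ) *
        coeff f ℓ m * coeff k ℓ 0 := by
  wlog hmeas : StronglyMeasurable f ∧ StronglyMeasurable k generalizing f k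
  · rw [conv_congr_ae hf.1.ae_eq_mk hk.1.ae_eq_mk, coeff_congr_ae hf.1.ae_eq_mk,
      coeff_congr_ae hk.1.ae_eq_mk]
    exact this ((memLp_congr_ae hf.1.ae_eq_mk).1 hf) ((memLp_congr_ae hk.1.ae_eq_mk).1 hk)
      ⟨hf.1.stronglyMeasurable_mk, hk.1.stronglyMeasurable_mk⟩
  obtain ⟨B, hB⟩ := exists_norm_sphericalHarmonic_le ℓ m hm
  obtain ⟨hint, heq⟩ := integral_conv_mul hf hk hmeas.1 hmeas.2
    (Complex.continuous_conj.comp (continuous_sphericalHarmonic ℓ m hm)).stronglyMeasurable B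
    (fun x => (RCLike.norm_conj _).trans_le (hB x))
  change coeff (conv f k) ℓ m = _ at heq
  simp only [Function.comp_apply] at hint heq
  set A : SO3 → ℂ := fun g =>
    ∫ x, k x * (starRingEnd ℂ) (sphericalHarmonic ℓ m (rotate g x)) ∂surfaceMeasure with hA
  have hR : ∀ (g : SO3) (j : ℕ), rotate (g * rotRoot ℓ j) northPole = rotate g northPole := by
    intro g j
    rw [rotate_mul, rotRoot, rotate_rotZ_northPole]
  have h1 : ∀ j, ∫ g, f (rotate g northPole) * A (g * rotRoot ℓ j) ∂haarSO3 =
      coeff (conv f k) ℓ m := by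
    intro j
    have h := integral_mul_right_eq_self (μ := haarSO3)
      (fun g => f (rotate g northPole) * A g) (rotRoot ℓ j)
    simp only [hR] at h
    rw [h, heq]
  have h2 : ∀ j, Integrable (fun g => f (rotate g northPole) * A (g * rotRoot ℓ j)) haarSO3 := by
    intro j
    simpa only [hR] using hint.comp_mul_right (rotRoot ℓ j)
  -- By `h1` the coefficient is also the average of these integrals, and by the mean value property
  -- the averaged integrand is a function of `g ν` times a constant.
  have hsum : ∀ g, ∑ j ∈ Finset.range (ℓ + 1), f (rotate g northPole) * A (g * rotRoot ℓ j) =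
      (f (rotate g northPole) *
        (starRingEnd ℂ) (sphericalHarmonic ℓ m (rotate g northPole))) *
        ((ℓ + 1) * ∫ x, k x * zonal ℓ x ∂surfaceMeasure) := by
    intro g
    rw [← Finset.mul_sum, hA,
      sum_integral_mul_conj_sphericalHarmonic (hk.integrable (by norm_num)) ℓ m hm g]
    ring
  have h3 : ((ℓ : ℂ) + 1) * coeff (conv f k) ℓ m = (2 * Real.pi * coeff f ℓ m) *
      ((ℓ + 1) * ∫ x, k x * zonal ℓ x ∂surfaceMeasure) := by
    have h4 : ∑ j ∈ Finset.range (ℓ + 1), coeff (conv f k) ℓ m =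
        ((ℓ : ℂ) + 1) * coeff (conv f k) ℓ m := by simp
    rw [← h4, ← Finset.sum_congr rfl fun j _ => h1 j, ← integral_finsetSum _ fun j _ => h2 j]
    simp_rw [hsum]
    rw [integral_mul_const, integral_rotate_haarSO3
      (F := fun y => f y * (starRingEnd ℂ) (sphericalHarmonic ℓ m y))
      (hf.1.mul (Complex.continuous_conj.comp
        (continuous_sphericalHarmonic ℓ m hm)).aestronglyMeasurable) northPole,
      Complex.real_smul, coeff]
    push_cast
    rfl
  have hℓ : (ℓ : ℂ) + 1 ≠ 0 := by exact_mod_cast Nat.succ_ne_zero ℓ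
  have hs : (Real.sqrt (4 * Real.pi / (2 * (ℓ : ℝ) + 1)) : ℂ) *
      (Real.sqrt ((2 * ℓ + 1) / (4 * Real.pi)) : ℂ) = 1 := by
    rw [← Complex.ofReal_mul, ← Real.sqrt_mul (by positivity), div_mul_div_cancel₀ (by positivity),
      div_self (by positivity), Real.sqrt_one, Complex.ofReal_one]
  rw [coeff_zero_eq]
  refine mul_left_cancel₀ hℓ ?_
  rw [h3]
  linear_combination -(2 * Real.pi * coeff f ℓ m * (ℓ + 1) *
    ∫ x, k x * zonal ℓ x ∂surfaceMeasure) * hs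

/-! ### Averaging over the stabilizer of the north pole -/

instance secondCountableTopology_SO3 : SecondCountableTopology SO3 :=
  have : SecondCountableTopology (Matrix (Fin 3) (Fin 3) ℝ) :=
    inferInstanceAs (SecondCountableTopology (Fin 3 → Fin 3 → ℝ))
  TopologicalSpace.Subtype.secondCountableTopology _

/-- The group of rotations fixing the north pole. -/
def poleStabilizer : Subgroup SO3 where
  carrier := {g | rotate g northPole = northPole}
  mul_mem' {a b} ha hb := by
    change rotate (a * b) northPole = northPole
    rw [rotate_mul, hb, ha]
  one_mem' := rotate_one _
  inv_mem' {a} ha := by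
    change rotate a⁻¹ northPole = northPole
    conv_lhs => rw [← show rotate a northPole = northPole from ha]
    exact rotate_inv_rotate a _

theorem rotate_coe_northPole (h : poleStabilizer) : rotate (h : SO3) northPole = northPole := h.2

instance compactSpace_poleStabilizer : CompactSpace poleStabilizer := by
  refine (isCompact_iff_compactSpace (s := (poleStabilizer : Set SO3))).1 (IsClosed.isCompact ?_)
  exact isClosed_eq (continuous_rotate_left northPole) continuous_const

/-- The Haar probability measure on the stabilizer of the north pole. -/
noncomputable def poleHaar : Measure poleStabilizer :=
  Measure.haarMeasure (⊤ : TopologicalSpace.PositiveCompacts poleStabilizer)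

instance isHaarMeasure_poleHaar : poleHaar.IsHaarMeasure :=
  inferInstanceAs (Measure.haarMeasure _).IsHaarMeasure

instance isProbabilityMeasure_poleHaar : IsProbabilityMeasure poleHaar :=
  ⟨by simpa [poleHaar] using
    Measure.haarMeasure_self (K₀ := (⊤ : TopologicalSpace.PositiveCompacts poleStabilizer))⟩

/-- The average of a function on the sphere over the rotations about the vertical axis. -/
noncomputable def zonalAverage (k : S2 → ℂ) (x : S2) : ℂ :=
  ∫ h : poleStabilizer, k (rotate h x) ∂poleHaar

theorem isZonal_zonalAverage (k : S2 → ℂ) : IsZonal (zonalAverage k) := by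
  intro g hg x
  have := isMulRightInvariant_of_compactSpace poleHaar
  have h := integral_mul_right_eq_self (μ := poleHaar)
    (fun h : poleStabilizer => k (rotate h x)) ⟨g, hg⟩
  simpa only [zonalAverage, Subgroup.coe_mul, rotate_mul] using h

theorem continuous_rotate_poleStabilizer :
    Continuous fun p : poleStabilizer × S2 => rotate (p.1 : SO3) p.2 :=
  continuous_rotate.comp (by fun_prop : Continuous fun p : poleStabilizer × S2 =>
    ((p.1 : SO3), p.2))

theorem stronglyMeasurable_zonalAverage {k : S2 → ℂ} (hk : StronglyMeasurable k) :
    StronglyMeasurable (zonalAverage k) :=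
  StronglyMeasurable.integral_prod_right
    (f := fun x (h : poleStabilizer) => k (rotate (h : SO3) x))
    (hk.comp_measurable (continuous_rotate_poleStabilizer.comp continuous_swap).measurable)

theorem sq_integral_le_integral_sq {α : Type*} [MeasurableSpace α] {μ : Measure α}
    [IsProbabilityMeasure μ] {u : α → ℝ} (h1 : Integrable u μ)
    (h2 : Integrable (fun a => u a ^ 2) μ) : (∫ a, u a ∂μ) ^ 2 ≤ ∫ a, u a ^ 2 ∂μ := by
  set c := ∫ a, u a ∂μ with hc
  have h3 : ∫ a, (2 * c * u a - c ^ 2) ∂μ ≤ ∫ a, u a ^ 2 ∂μ :=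
    integral_mono ((h1.const_mul _).sub (integrable_const _)) h2 fun a => by
      simp only
      nlinarith [sq_nonneg (u a - c)]
  rw [integral_sub (h1.const_mul _) (integrable_const _), integral_const_mul, ← hc,
    integral_const] at h3
  simp only [probReal_univ, one_smul] at h3
  linarith

theorem memLp_zonalAverage {k : S2 → ℂ} (hkm : StronglyMeasurable k)
    (hk : MemLp k 2 surfaceMeasure) : MemLp (zonalAverage k) 2 surfaceMeasure := by
  have hsq : Integrable (fun p : poleStabilizer × S2 => ‖k (rotate (p.1 : SO3) p.2)‖ ^ 2)
      (poleHaar.prod surfaceMeasure) := by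
    refine integrable_prod_of_section_bound
      ((hkm.comp_measurable continuous_rotate_poleStabilizer.measurable).norm.pow 2)
      (fun h => ?_) (∫ x, ‖k x‖ ^ 2 ∂surfaceMeasure) fun h => ?_
    · exact (measurePreserving_rotate (h : SO3)).integrable_comp_of_integrable
        (g := fun x => ‖k x‖ ^ 2) hk.norm.integrable_sq
    · simp only [norm_pow, norm_norm]
      exact (integral_comp_rotate (h : SO3) fun x => ‖k x‖ ^ 2).le
  have hm := (stronglyMeasurable_zonalAverage hkm).aestronglyMeasurable (μ := surfaceMeasure)
  refine (memLp_two_iff_integrable_sq_norm hm).2 ?_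
  refine hsq.integral_prod_right.mono' (hm.norm.pow 2) ?_
  -- For the remaining `x` the section may fail to be integrable over the stabilizer, and
  -- `zonalAverage k x` is the junk value `0`.
  filter_upwards [hsq.prod_left_ae] with x hx
  have hmx : AEStronglyMeasurable (fun h : poleStabilizer => k (rotate (h : SO3) x)) poleHaar :=
    (hkm.comp_measurable (continuous_rotate_poleStabilizer.comp
      (by fun_prop : Continuous fun h : poleStabilizer => (h, x))).measurable).aestronglyMeasurable
  have hi : Integrable (fun h : poleStabilizer => k (rotate (h : SO3) x)) poleHaar :=
    ((memLp_two_iff_integrable_sq_norm hmx).2 hx).integrable (by norm_num)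
  rw [norm_pow, norm_norm]
  exact (pow_le_pow_left₀ (norm_nonneg _) (norm_integral_le_integral_norm _) 2).trans
    (sq_integral_le_integral_sq hi.norm hx)

/-- Right translation of the integration variable by a rotation fixing the north pole. -/
theorem conv_comp_rotate (f k : S2 → ℂ) (h : poleStabilizer) (x : S2) :
    ∫ g, f (rotate g northPole) * k (rotate (h : SO3) (rotate g⁻¹ x)) ∂haarSO3 =
      conv f k x := by
  have e := integral_mul_right_eq_self (μ := haarSO3)
    (fun g => f (rotate g northPole) * k (rotate g⁻¹ x)) (h : SO3)⁻¹
  rw [conv, ← e]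
  have h' : rotate (h : SO3)⁻¹ northPole = northPole := (h⁻¹).2
  simp only [mul_inv_rev, inv_inv, rotate_mul, h']

theorem conv_zonalAverage {f k : S2 → ℂ} (hf : MemLp f 2 surfaceMeasure)
    (hk : MemLp k 2 surfaceMeasure) (hkm : StronglyMeasurable k) (x : S2) :
    conv f (zonalAverage k) x = conv f k x := by
  wlog hfm : StronglyMeasurable f generalizing f
  · rw [conv_congr_ae hf.1.ae_eq_mk (ae_eq_refl k),
      conv_congr_ae hf.1.ae_eq_mk (ae_eq_refl (zonalAverage k))]
    exact this ((memLp_congr_ae hf.1.ae_eq_mk).1 hf) hf.1.stronglyMeasurable_mk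
  have hc : Continuous fun p : poleStabilizer × SO3 => rotate (p.1 : SO3) (rotate p.2⁻¹ x) :=
    continuous_rotate_poleStabilizer.comp ((continuous_fst).prodMk
      ((continuous_rotate_left x).comp (continuous_inv.comp continuous_snd)))
  have hm : StronglyMeasurable fun p : poleStabilizer × SO3 =>
      f (rotate p.2 northPole) * k (rotate (p.1 : SO3) (rotate p.2⁻¹ x)) :=
    (hfm.comp_measurable
      ((continuous_rotate_left northPole).comp continuous_snd).measurable).mul
      (hkm.comp_measurable hc.measurable)
  have hki : ∀ h : poleStabilizer, MemLp (fun y => k (rotate (h : SO3) y)) 2 surfaceMeasure :=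
    fun h => hk.comp_measurePreserving (measurePreserving_rotate (h : SO3))
  have hi := integrable_prod_of_section_bound (μ := poleHaar) (μ' := haarSO3) hm
    (fun h => integrable_conv_integrand hf (hki h) x)
    (2 * Real.pi * (∫ y, ‖f y‖ ^ 2 ∂surfaceMeasure + ∫ y, ‖k y‖ ^ 2 ∂surfaceMeasure))
    (fun h => (integral_norm_mul_le hf (hki h) x).trans_eq (by
      rw [integral_comp_rotate (h : SO3) fun y => ‖k y‖ ^ 2]))
  have hswap := integral_integral_swap
    (f := fun (h : poleStabilizer) g =>
      f (rotate g northPole) * k (rotate (h : SO3) (rotate g⁻¹ x))) hi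
  simp_rw [conv_comp_rotate, integral_const_mul] at hswap
  rw [integral_const, probReal_univ, one_smul] at hswap
  exact hswap.symm

theorem rotate_coord_two {g : SO3} (hg : rotate g northPole = northPole) (x : S2) :
    (rotate g x : E3) 2 = (x : E3) 2 := by
  have h : ∀ y : S2, (y : E3) 2 = inner ℝ (northPole : E3) (y : E3) := by
    intro y
    simp [northPole, PiLp.inner_apply, Fin.sum_univ_three]
  rw [h, h, coe_rotate]
  conv_lhs => rw [← hg, coe_rotate, LinearIsometryEquiv.inner_map_map]

theorem zonal_rotate (ℓ : ℕ) {g : SO3} (hg : rotate g northPole = northPole) (x : S2) :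
    zonal ℓ (rotate g x) = zonal ℓ x := by
  rw [zonal_eq_taylorCoeff, zonal_eq_taylorCoeff, rotate_coord_two hg]

theorem coeff_of_isZonal {k : S2 → ℂ} (hk : Integrable k surfaceMeasure) (hz : IsZonal k)
    (ℓ : ℕ) (m : ℤ) (hm : |m| ≤ (ℓ : ℤ)) :
    coeff k ℓ m = (starRingEnd ℂ) (sphericalHarmonic ℓ m northPole) *
      ∫ x, k x * zonal ℓ x ∂surfaceMeasure := by
  have h1 : ∀ j, ∫ x, k x * (starRingEnd ℂ) (sphericalHarmonic ℓ m (rotate (1 * rotRoot ℓ j) x))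
      ∂surfaceMeasure = coeff k ℓ m := by
    intro j
    have h := integral_comp_rotate (rotRoot ℓ j)
      fun x => k x * (starRingEnd ℂ) (sphericalHarmonic ℓ m x)
    simpa only [coeff, one_mul, hz (rotRoot ℓ j) (rotate_rotZ_northPole _)] using h
  have h2 := sum_integral_mul_conj_sphericalHarmonic hk ℓ m hm 1
  simp_rw [h1] at h2
  have hℓ : (ℓ : ℂ) + 1 ≠ 0 := by exact_mod_cast Nat.succ_ne_zero ℓ
  refine mul_left_cancel₀ hℓ ?_
  rw [rotate_one] at h2
  rw [← h2]
  simp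

theorem coeff_zonalAverage_zero {k : S2 → ℂ} (hk : Integrable k surfaceMeasure)
    (hkm : StronglyMeasurable k) (ℓ : ℕ) : coeff (zonalAverage k) ℓ 0 = coeff k ℓ 0 := by
  rw [coeff_zero_eq, coeff_zero_eq]
  congr 1
  have hzc := continuous_zonal ℓ
  obtain ⟨B, hB⟩ := isCompact_univ.exists_bound_of_continuousOn hzc.continuousOn
  have hint : Integrable (fun x => k x * zonal ℓ x) surfaceMeasure :=
    hk.mul_bdd (c := B) hzc.aestronglyMeasurable (.of_forall fun x => hB x trivial)
  have hm : StronglyMeasurable fun x => k x * zonal ℓ x := hkm.mul hzc.stronglyMeasurable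
  have hi := integrable_prod_of_section_bound (μ := poleHaar) (μ' := surfaceMeasure)
    (hm.comp_measurable continuous_rotate_poleStabilizer.measurable)
    (fun h => (measurePreserving_rotate (h : SO3)).integrable_comp_of_integrable
      (g := fun x => k x * zonal ℓ x) hint)
    (∫ x, ‖k x * zonal ℓ x‖ ∂surfaceMeasure)
    (fun h => (integral_comp_rotate (h : SO3) fun x => ‖k x * zonal ℓ x‖).le)
  have hswap := integral_integral_swap (f := fun (h : poleStabilizer) x =>
    k (rotate (h : SO3) x) * zonal ℓ (rotate (h : SO3) x)) hi
  simp_rw [fun h : poleStabilizer =>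
    integral_comp_rotate (h : SO3) fun x => k x * zonal ℓ x] at hswap
  rw [integral_const, probReal_univ, one_smul] at hswap
  rw [hswap]
  refine integral_congr_ae (.of_forall fun x => ?_)
  simp only [zonal_rotate ℓ (rotate_coe_northPole _), integral_mul_const, zonalAverage]

end SphericalConv

theorem mainTheorem5 (k : SphericalConv.S2 → ℂ)
    (hk : MeasureTheory.MemLp k 2 SphericalConv.surfaceMeasure) :
    (∀ f : SphericalConv.S2 → ℂ, MeasureTheory.MemLp f 2 SphericalConv.surfaceMeasure →
      (∀ x : SphericalConv.S2, MeasureTheory.Integrable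
        (fun g : SphericalConv.SO3 =>
          f (SphericalConv.rotate g SphericalConv.northPole) * k (SphericalConv.rotate g⁻¹ x))
        SphericalConv.haarSO3) ∧
      MeasureTheory.MemLp (SphericalConv.conv f k) 2 SphericalConv.surfaceMeasure ∧
      ∀ (ℓ : ℕ) (m : ℤ), |m| ≤ (ℓ : ℤ) →
        SphericalConv.coeff (SphericalConv.conv f k) ℓ m =
          2 * (Real.pi : ℂ) * (Real.sqrt (4 * Real.pi / (2 * (ℓ : ℝ) + 1)) : ℂ) *
            SphericalConv.coeff f ℓ m * SphericalConv.coeff k ℓ 0) ∧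
    (∃ k₀ : SphericalConv.S2 → ℂ,
      MeasureTheory.MemLp k₀ 2 SphericalConv.surfaceMeasure ∧
      SphericalConv.IsZonal k₀ ∧
      (∀ ℓ : ℕ, SphericalConv.coeff k₀ ℓ 0 = SphericalConv.coeff k ℓ 0) ∧
      (∀ (ℓ : ℕ) (m : ℤ), |m| ≤ (ℓ : ℤ) → m ≠ 0 → SphericalConv.coeff k₀ ℓ m = 0) ∧
      ∀ f : SphericalConv.S2 → ℂ, MeasureTheory.MemLp f 2 SphericalConv.surfaceMeasure →
        ∀ x : SphericalConv.S2, SphericalConv.conv f k x = SphericalConv.conv f k₀ x) := by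
  have hk' := (MeasureTheory.memLp_congr_ae hk.1.ae_eq_mk).1 hk
  have hkm := hk.1.stronglyMeasurable_mk
  have hk₀ := SphericalConv.memLp_zonalAverage hkm hk'
  refine ⟨fun f hf => ⟨SphericalConv.integrable_conv_integrand hf hk,
      SphericalConv.memLp_conv hf hk, SphericalConv.coeff_conv hf hk⟩,
    SphericalConv.zonalAverage (hk.1.mk k), hk₀, SphericalConv.isZonal_zonalAverage _,
    fun ℓ => ?_, fun ℓ m hm h0 => ?_,
    fun f hf x => ?_⟩
  · rw [SphericalConv.coeff_zonalAverage_zero (hk'.integrable (by norm_num)) hkm,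
      SphericalConv.coeff_congr_ae hk.1.ae_eq_mk.symm]
  · rw [SphericalConv.coeff_of_isZonal (hk₀.integrable (by norm_num))
        (SphericalConv.isZonal_zonalAverage _) ℓ m hm,
      SphericalConv.sphericalHarmonic_northPole ℓ m hm h0, map_zero, zero_mul]
  · rw [SphericalConv.conv_zonalAverage hf hk' hkm,
      SphericalConv.conv_congr_ae (Filter.EventuallyEq.refl _ f) hk.1.ae_eq_mk]
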